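/- A \emph{bi-modal G\"odel algebra} is an algebra $A=(G,I,K)$, where $G$ is a G\"odel algebra (a Heyting algebra satisfying $(a\to b)\vee(b\to a)=1$) and $I,K$ are unary operations on $G$ such that for all $a,b\in G$ $$I(a\wedge b)=Ia\wedge Ib,\quad I1=1,\quad K(a\vee b)=Ka\vee Kb,\quad K0=0,$$ $$Ka\to Ib\le I(a\to b),\quad K(a\to b)\le Ia\to Kb .$$ A \emph{G\"odel-Kripke frame} is a pair $\mathcal F=(W,S)$ with $W$ a non-empty set and $S:W\times W\to[0,1]$ an arbitrary function. Its \emph{G\"odel complex algebra} $[0,1]^{\mathcal F}$ is the power $[0,1]^W$ of the standard G\"odel algebra $[0,1]$ (with residuum $\Rightarrow$), with the operations $$I(f)(w)=\inf_{w'\in W}\big(S(w,w')\Rightarrow f(w')\big),\qquad K(f)(w)=\sup_{w'\in W}\min\big(S(w,w'),f(w')\big).$$ The variety generated by a class of algebras is the smallest class containing it that is closed under homomorphic images, subalgebras and direct products. \textbf{Theorem.} The G\"odel complex algebras generate the variety of all bi-modal G\"odel algebras. Moreover, consider the following three properties of frames, each with a pair of identities of algebras: \emph{reflexivity}: $S(x,x)=1$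 for all $x$; $\quad Ia\le a$ and $a\le Ka$; \emph{transitivity}: $\min(S(x,y),S(y,z))\le S(x,z)$ for all $x,y,z$; $\quad Ia\le IIa$ and $KKa\le Ka$; \emph{symmetry}: $S(x,y)=S(y,x)$ for all $x,y$; $\quad a\le IKa$ and $KIa\le a$. For every subset $P$ of these three properties, the subvariety of bi-modal G\"odel algebras determined by the pairs of identities in $P$ is generated by the complex algebras of the frames having all the properties in $P$; it is also generated by the complex algebras that belong to it. -/

import Mathlib

/-- A bi-modal Gödel algebra: a Heyting algebra satisfying prelinearity (a Gödel algebra),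
with two unary operations `box` (written `I`) and `dia` (written `K`). -/
class BimodalGodelAlgebra (A : Type*) extends HeytingAlgebra A where
  box : A → A
  dia : A → A
  prelinear : ∀ a b : A, (a ⇨ b) ⊔ (b ⇨ a) = ⊤
  box_inf : ∀ a b : A, box (a ⊓ b) = box a ⊓ box b
  dia_sup : ∀ a b : A, dia (a ⊔ b) = dia a ⊔ dia b
  box_top : box ⊤ = ⊤
  dia_bot : dia ⊥ = ⊥
  dia_himp_box_le : ∀ a b : A, (dia a ⇨ box b) ≤ box (a ⇨ b)
  dia_himp_le : ∀ a b : A, dia (a ⇨ b) ≤ (box a ⇨ dia b)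

open BimodalGodelAlgebra (box dia)

/-- Homomorphisms of bi-modal Gödel algebras: Heyting homomorphisms commuting with both
modal operations. -/
structure BimodalGodelHom (A B : Type*) [BimodalGodelAlgebra A] [BimodalGodelAlgebra B]
    extends HeytingHom A B where
  map_box : ∀ a : A, toFun (box a) = box (toFun a)
  map_dia : ∀ a : A, toFun (dia a) = dia (toFun a)

/-- The direct product of a family of bi-modal Gödel algebras, with coordinatewise operations. -/
instance Pi.instBimodalGodelAlgebra {ι : Type*} {A : ι → Type*}
    [∀ i, BimodalGodelAlgebra (A i)] : BimodalGodelAlgebra (∀ i, A i) where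
  box f := fun i => box (f i)
  dia f := fun i => dia (f i)
  prelinear a b := funext fun i => BimodalGodelAlgebra.prelinear (a i) (b i)
  box_inf a b := funext fun i => BimodalGodelAlgebra.box_inf (a i) (b i)
  dia_sup a b := funext fun i => BimodalGodelAlgebra.dia_sup (a i) (b i)
  box_top := funext fun _ => BimodalGodelAlgebra.box_top
  dia_bot := funext fun _ => BimodalGodelAlgebra.dia_bot
  dia_himp_box_le a b := fun i => BimodalGodelAlgebra.dia_himp_box_le (a i) (b i)
  dia_himp_le a b := fun i => BimodalGodelAlgebra.dia_himp_le (a i) (b i)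

universe u

/-- Bundled bi-modal Gödel algebras. -/
structure BimodalGodelAlg : Type (u + 1) where
  carrier : Type u
  [str : BimodalGodelAlgebra carrier]

attribute [instance] BimodalGodelAlg.str

/-- A variety of bi-modal Gödel algebras: a class of such algebras closed under homomorphic
images, subalgebras (given as injective homomorphisms, so that the class is also closed under
isomorphism) and direct products. -/
structure IsBimodalGodelVariety (C : Set BimodalGodelAlg.{u}) : Prop where
  homImage_mem : ∀ A ∈ C, ∀ (B : BimodalGodelAlg.{u}) (f : BimodalGodelHom A.carrier B.carrier),
    Function.Surjective f.toFun → B ∈ C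
  subalgebra_mem : ∀ A ∈ C, ∀ (B : BimodalGodelAlg.{u})
    (f : BimodalGodelHom B.carrier A.carrier), Function.Injective f.toFun → B ∈ C
  product_mem : ∀ (ι : Type u) (A : ι → BimodalGodelAlg.{u}), (∀ i, A i ∈ C) →
    (⟨∀ i, (A i).carrier⟩ : BimodalGodelAlg.{u}) ∈ C

/-- The variety generated by a class `K`: the smallest variety containing `K`. -/
def generatedVariety (K : Set BimodalGodelAlg.{u}) : Set BimodalGodelAlg.{u} :=
  ⋂₀ {C | IsBimodalGodelVariety C ∧ K ⊆ C}

/-- A Gödel-Kripke frame: a nonempty set of worlds with a `[0,1]`-valued accessibility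
relation. -/
structure GKFrame : Type (u + 1) where
  World : Type u
  [nonempty : Nonempty World]
  S : World → World → unitInterval

/-- The underlying set `[0,1]^W` of the complex algebra of a frame. -/
def GKFrame.Complex (F : GKFrame.{u}) : Type u := F.World → unitInterval

/-- The Gödel complex algebra `[0,1]^F`: the power `[0,1]^W` of the standard Gödel algebra, with
`I f w = inf_{w'} (S w w' ⇒ f w')` and `K f w = sup_{w'} (S w w' ⊓ f w')`. -/
noncomputable instance GKFrame.instComplex (F : GKFrame.{u}) : BimodalGodelAlgebra F.Complex where
  toHeytingAlgebra := (Pi.instHeytingAlgebra : HeytingAlgebra (F.World → unitInterval))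
  box f := fun w => ⨅ w', (F.S w w' ⇨ f w')
  dia f := fun w => ⨆ w', (F.S w w' ⊓ f w')
  prelinear a b := funext fun w => by
    change (a w ⇨ b w) ⊔ (b w ⇨ a w) = ⊤
    rcases le_total (a w) (b w) with h | h
    · rw [himp_eq_top_iff.2 h, top_sup_eq]
    · rw [himp_eq_top_iff.2 h, sup_top_eq]
  box_inf a b := funext fun w => by
    change (⨅ w', (F.S w w' ⇨ (a w' ⊓ b w'))) =
      (⨅ w', (F.S w w' ⇨ a w')) ⊓ (⨅ w', (F.S w w' ⇨ b w'))
    simp only [himp_inf_distrib, iInf_inf_eq]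
  dia_sup a b := funext fun w => by
    change (⨆ w', (F.S w w' ⊓ (a w' ⊔ b w'))) =
      (⨆ w', (F.S w w' ⊓ a w')) ⊔ (⨆ w', (F.S w w' ⊓ b w'))
    simp only [inf_sup_left, iSup_sup_eq]
  box_top := funext fun w => by
    change (⨅ w', (F.S w w' ⇨ (⊤ : unitInterval))) = ⊤
    simp only [himp_top, iInf_top]
  dia_bot := funext fun w => by
    change (⨆ w', (F.S w w' ⊓ (⊥ : unitInterval))) = ⊥
    simp only [inf_bot_eq, iSup_bot]
  dia_himp_box_le a b := fun w => by
    change ((⨆ w', (F.S w w' ⊓ a w')) ⇨ (⨅ w', (F.S w w' ⇨ b w'))) ≤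
      ⨅ w', (F.S w w' ⇨ (a w' ⇨ b w'))
    refine le_iInf fun v => ?_
    rw [le_himp_iff, le_himp_iff]
    set D := ⨆ w', (F.S w w' ⊓ a w')
    set B := ⨅ w', (F.S w w' ⇨ b w')
    have h1 : (D ⇨ B) ⊓ F.S w v ⊓ a v ≤ D :=
      le_trans (le_inf (inf_le_left.trans inf_le_right) inf_le_right)
        (le_iSup (fun w' => F.S w w' ⊓ a w') v)
    have h2 : (D ⇨ B) ⊓ F.S w v ⊓ a v ≤ B :=
      le_trans (le_inf (inf_le_left.trans inf_le_left) h1) himp_inf_le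
    have h3 : (D ⇨ B) ⊓ F.S w v ⊓ a v ≤ F.S w v ⇨ b v :=
      h2.trans (iInf_le (fun w' => F.S w w' ⇨ b w') v)
    exact le_trans (le_inf h3 (inf_le_left.trans inf_le_right)) himp_inf_le
  dia_himp_le a b := fun w => by
    change (⨆ w', (F.S w w' ⊓ (a w' ⇨ b w'))) ≤
      ((⨅ w', (F.S w w' ⇨ a w')) ⇨ (⨆ w', (F.S w w' ⊓ b w')))
    refine iSup_le fun v => ?_
    rw [le_himp_iff]
    refine le_trans ?_ (le_iSup (fun w' => F.S w w' ⊓ b w') v)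
    have hS : F.S w v ⊓ (a v ⇨ b v) ⊓ (⨅ w', (F.S w w' ⇨ a w')) ≤ F.S w v :=
      inf_le_left.trans inf_le_left
    have ha : F.S w v ⊓ (a v ⇨ b v) ⊓ (⨅ w', (F.S w w' ⇨ a w')) ≤ a v :=
      le_trans (le_inf (inf_le_right.trans (iInf_le (fun w' => F.S w w' ⇨ a w') v)) hS)
        himp_inf_le
    exact le_inf hS (le_trans (le_inf (inf_le_left.trans inf_le_right) ha) himp_inf_le)

/-- The Gödel complex algebra of a frame, bundled. -/
noncomputable def complexAlgebra (F : GKFrame.{u}) : BimodalGodelAlg.{u} := ⟨F.Complex⟩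

/-- The three properties of frames, and pairs of identities of algebras, under consideration. -/
inductive ModalProperty
  | reflexivity
  | transitivity
  | symmetry

/-- The `[0,1]`-valued frame properties. -/
def GKFrame.Has (F : GKFrame.{u}) : ModalProperty → Prop
  | .reflexivity => ∀ x, F.S x x = 1
  | .transitivity => ∀ x y z, F.S x y ⊓ F.S y z ≤ F.S x z
  | .symmetry => ∀ x y, F.S x y = F.S y x

/-- The pairs of identities (an inequality `s ≤ t` abbreviates the identity `s ⊓ t = s`). -/
def BimodalGodelAlg.Satisfies (A : BimodalGodelAlg.{u}) : ModalProperty → Prop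
  | .reflexivity => (∀ a : A.carrier, box a ≤ a) ∧ (∀ a : A.carrier, a ≤ dia a)
  | .transitivity =>
      (∀ a : A.carrier, box a ≤ box (box a)) ∧ (∀ a : A.carrier, dia (dia a) ≤ dia a)
  | .symmetry => (∀ a : A.carrier, a ≤ box (dia a)) ∧ (∀ a : A.carrier, dia (box a) ≤ a)

/-- The subvariety of bi-modal Gödel algebras determined by a combination of the pairs of
identities. -/
def modalSubvariety (P : Set ModalProperty) : Set BimodalGodelAlg.{u} :=
  {A | ∀ p ∈ P, A.Satisfies p}

/-! An algebra lies in a variety once every equation failing in it fails in some member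
(`IsBimodalGodelVariety.mem_of_separating`), so it suffices to refute a failing equation in the
complex algebra of a suitable frame. Let `F` be the finite set of subterm values. Prelinearity makes
`A/q` a chain for each prime filter `q`; a world is an embedding of a finite part of such a chain
into `[0,1]`. Accessibility over `F` is the largest degree `S` with `v (box a) ≤ (S ⇨ w a)` and `S ⊓
w a ≤ v (dia a)` for all `a ∈ F`.

The truth lemma needs successors that realize the values of `box c` and `dia c` at `v`. Prime filter
separation supplies `q`, and `exists_realizes_between` embeds a finite part of `A/q` between bounds:
the values `v (box a)` from below and `v (dia a)` from above, for those lying under a cut of `A/p`.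
The two mixed axioms make these bounds compatible. The supremum for `dia` is attained; the infimum
for `box` is only approached.

Transitivity and symmetry are built into the frame by shrinking `S`. The identities show that this
loses no witnesses: accessibility over the one-step modal hull of `F` already lies below the smaller
`S` (`accessibility_modalHull_le`), and witnesses are constructed for the hull. -/

/-! ### Prime filters and their chain quotients. -/

section PrimeFilters

/-- Prime filters of a Heyting algebra. -/
structure IsPrimeFilter {A : Type*} [HeytingAlgebra A] (q : Set A) : Prop where
  top_mem : ⊤ ∈ q
  bot_notMem : ⊥ ∉ q
  mem_of_le : ∀ {a b : A}, a ≤ b → a ∈ q → b ∈ q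
  inf_mem : ∀ {a b : A}, a ∈ q → b ∈ q → a ⊓ b ∈ q
  mem_or_mem : ∀ {a b : A}, a ⊔ b ∈ q → a ∈ q ∨ b ∈ q

/-- The prime filter theorem: a filter disjoint from an ideal extends to a prime filter
disjoint from it. -/
theorem exists_primeFilter {A : Type*} [HeytingAlgebra A] (Q J : Set A)
    (Q_top : ⊤ ∈ Q) (Q_le : ∀ a b, a ≤ b → a ∈ Q → b ∈ Q)
    (Q_inf : ∀ a b, a ∈ Q → b ∈ Q → a ⊓ b ∈ Q)
    (J_bot : ⊥ ∈ J) (J_le : ∀ a b, a ≤ b → b ∈ J → a ∈ J)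
    (J_sup : ∀ a b, a ∈ J → b ∈ J → a ⊔ b ∈ J) (hQJ : ∀ a ∈ Q, a ∉ J) :
    ∃ q : Set A, IsPrimeFilter q ∧ Q ⊆ q ∧ ∀ a ∈ J, a ∉ q := by
  have hQ : Order.IsPFilter Q := Order.IsPFilter.of_def ⟨⊤, Q_top⟩
    (fun a ha b hb => ⟨a ⊓ b, Q_inf a b ha hb, inf_le_left, inf_le_right⟩)
    (fun h ha => Q_le _ _ h ha)
  have hJ : Order.IsIdeal J := ⟨fun a b h ha => J_le b a h ha, ⟨⊥, J_bot⟩,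
    fun a ha b hb => ⟨a ⊔ b, J_sup a b ha hb, le_sup_left, le_sup_right⟩⟩
  obtain ⟨M, hM, hJM, hQM⟩ := DistribLattice.prime_ideal_of_disjoint_filter_ideal
    (F := hQ.toPFilter) (I := hJ.toIdeal) (Set.disjoint_left.2 hQJ)
  have hQM' : ∀ a ∈ Q, a ∉ M := fun a ha => Set.disjoint_left.1 hQM ha
  refine ⟨(M : Set A)ᶜ, ⟨hQM' ⊤ Q_top, fun h => h M.bot_mem,
    fun h ha hb => ha (M.lower h hb), fun ha hb h => ?_, fun {a b} h => ?_⟩, hQM',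
    fun a ha h => h (hJM ha)⟩
  · exact (hM.mem_or_mem h).elim ha hb
  · by_contra hab
    simp only [Set.mem_compl_iff, not_or, not_not] at hab
    exact h (Order.Ideal.sup_mem hab.1 hab.2)

namespace IsPrimeFilter

variable {A : Type*}

theorem himp_mem_of_le [HeytingAlgebra A] {q : Set A} (hq : IsPrimeFilter q) {a b : A}
    (h : a ≤ b) : a ⇨ b ∈ q := by
  rw [himp_eq_top_iff.2 h]
  exact hq.top_mem

theorem himp_trans [HeytingAlgebra A] {q : Set A} (hq : IsPrimeFilter q) {a b c : A}
    (h : a ⇨ b ∈ q) (h' : b ⇨ c ∈ q) : a ⇨ c ∈ q := by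
  refine hq.mem_of_le ?_ (hq.inf_mem h h')
  rw [le_himp_iff]
  refine le_trans (le_inf (inf_le_left.trans inf_le_right) ?_) himp_inf_le
  exact le_trans (inf_le_inf_right _ inf_le_left) himp_inf_le

theorem himp_mem_or [BimodalGodelAlgebra A] {q : Set A} (hq : IsPrimeFilter q) (a b : A) :
    a ⇨ b ∈ q ∨ b ⇨ a ∈ q :=
  hq.mem_or_mem (by rw [BimodalGodelAlgebra.prelinear]; exact hq.top_mem)

/-- In the chain `A/q`, the residuum `a ⇨ b` is at most `b` unless `a ≤ b`. -/
theorem himp_himp_mem [BimodalGodelAlgebra A] {q : Set A} (hq : IsPrimeFilter q) {a b : A}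
    (h : a ⇨ b ∉ q) : (a ⇨ b) ⇨ b ∈ q := by
  -- Compare `a` with `a ⇨ b` in the chain: `a ⇨ (a ⇨ b)` is `a ⇨ b`, which is not in `q`.
  have h1 := (hq.himp_mem_or a (a ⇨ b)).resolve_left (by rwa [himp_idem])
  refine hq.mem_of_le ?_ h1
  rw [le_himp_iff]
  exact le_trans (le_inf inf_le_right himp_inf_le) himp_inf_le

end IsPrimeFilter

end PrimeFilters

/-! ### Embedding finite parts of chains between bounds. -/

section Interpolation

/-- `v` is an order embedding of the finite part `D` of the chain `A/q` into `[0,1]` that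
preserves the bounds. -/
structure Realizes {A : Type*} [HeytingAlgebra A] (D : Finset A) (q : Set A)
    (v : A → unitInterval) : Prop where
  bot_mem : ⊥ ∈ D
  top_mem : ⊤ ∈ D
  map_bot : v ⊥ = 0
  map_top : v ⊤ = 1
  le_iff : ∀ {a b : A}, a ∈ D → b ∈ D → (v a ≤ v b ↔ a ⇨ b ∈ q)

theorem exists_pos_forall_le {ι : Type*} (s : Finset ι) (f : ι → ℝ) (h : ∀ i ∈ s, 0 < f i) :
    ∃ η > 0, ∀ i ∈ s, η ≤ f i := by
  have h1 : ∀ᶠ η in nhdsWithin (0 : ℝ) (Set.Ioi 0), ∀ i ∈ s, η ≤ f i :=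
    (Filter.eventually_all_finset s).2 fun i hi =>
      nhdsWithin_le_nhds ((eventually_lt_nhds (h i hi)).mono fun _ => le_of_lt)
  obtain ⟨η, h2, h3⟩ := (h1.and self_mem_nhdsWithin).exists
  exact ⟨η, h3, h2⟩

open Classical in
/-- A finite part of the chain `A/q` embeds into `[0,1]` subject to finitely many lower and upper
bounds, provided these are compatible. -/
theorem exists_realizes_between {A : Type*} [BimodalGodelAlgebra A] {q : Set A}
    (hq : IsPrimeFilter q) (D : Finset A) (hbot : ⊥ ∈ D) (htop : ⊤ ∈ D)
    (L U : Finset (A × unitInterval)) (hLbot : (⊥, 0) ∈ L) (hLtop : (⊤, 1) ∈ L)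
    (hUbot : (⊥, 0) ∈ U) (hUtop : (⊤, 1) ∈ U)
    (hle : ∀ x ∈ L, ∀ y ∈ U, x.1 ⇨ y.1 ∈ q → x.2 ≤ y.2)
    (hlt : ∀ x ∈ L, ∀ y ∈ U, y.1 ⇨ x.1 ∉ q → x.2 < y.2) :
    ∃ w : A → unitInterval, Realizes D q w ∧ (∀ x ∈ L, x.2 ≤ w x.1) ∧ ∀ y ∈ U, w y.1 ≤ y.2 := by
  -- `l` and `u` are the tightest monotone bounds induced by `L` and `U`; `r a` counts the elements
  -- of `D` strictly below `a` in `A/q`.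
  let l : A → unitInterval := fun a => (L.filter fun x => x.1 ⇨ a ∈ q).sup Prod.snd
  let u : A → unitInterval := fun a => (U.filter fun y => a ⇨ y.1 ∈ q).inf Prod.snd
  let r : A → ℕ := fun a => (D.filter fun d => a ⇨ d ∉ q).card
  have hlu : ∀ a, l a ≤ u a := fun a => Finset.sup_le fun x hx => Finset.le_inf fun y hy => by
    rw [Finset.mem_filter] at hx hy
    exact hle x hx.1 y hy.1 (hq.himp_trans hx.2 hy.2)
  have hlu' : ∀ a b, b ⇨ a ∉ q → l a < u b := fun a b hab => by
    have hab' := (hq.himp_mem_or a b).resolve_right hab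
    have key : ∀ x ∈ L, x.1 ⇨ a ∈ q → ∀ y ∈ U, b ⇨ y.1 ∈ q → x.2 < y.2 :=
      fun x hx hxa y hy hby => hlt x hx y hy fun h =>
        hab (hq.himp_trans (hq.himp_trans hby h) hxa)
    have hpos : ∀ y ∈ U.filter fun y => b ⇨ y.1 ∈ q, (0 : unitInterval) < y.2 := fun y hy => by
      rw [Finset.mem_filter] at hy
      exact key _ hLbot (hq.himp_mem_of_le bot_le) y hy.1 hy.2
    refine (Finset.sup_lt_iff ?_).2 fun x hx => (Finset.lt_inf_iff ?_).2 fun y hy => ?_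
    · exact (Finset.lt_inf_iff (zero_lt_one (α := unitInterval))).2 hpos
    · rw [Finset.mem_filter] at hx
      exact key x hx.1 hx.2 _ hUtop (hq.himp_mem_of_le le_top)
    · rw [Finset.mem_filter] at hx hy
      exact key x hx.1 hx.2 y hy.1 hy.2
  have l_mono : ∀ a b, a ⇨ b ∈ q → l a ≤ l b := fun a b hab =>
    Finset.sup_mono fun x hx => by
      rw [Finset.mem_filter] at hx ⊢
      exact ⟨hx.1, hq.himp_trans hx.2 hab⟩
  have u_mono : ∀ a b, a ⇨ b ∈ q → u a ≤ u b := fun a b hab =>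
    Finset.inf_mono fun x hx => by
      rw [Finset.mem_filter] at hx ⊢
      exact ⟨hx.1, hq.himp_trans hab hx.2⟩
  have r_sub : ∀ a b, a ⇨ b ∈ q →
      (D.filter fun d => a ⇨ d ∉ q) ⊆ D.filter fun d => b ⇨ d ∉ q := fun a b hab d hd => by
    rw [Finset.mem_filter] at hd ⊢
    exact ⟨hd.1, fun h => hd.2 (hq.himp_trans hab h)⟩
  have r_mono : ∀ a b, a ⇨ b ∈ q → r a ≤ r b := fun a b hab => Finset.card_le_card (r_sub a b hab)
  have r_lt : ∀ a b, a ∈ D → b ⇨ a ∉ q → r a < r b := fun a b ha hab => by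
    refine Finset.card_lt_card (Finset.ssubset_iff_subset_ne.2
      ⟨r_sub a b ((hq.himp_mem_or a b).resolve_right hab), fun h => ?_⟩)
    have h1 : a ∈ D.filter fun d => b ⇨ d ∉ q := Finset.mem_filter.2 ⟨ha, hab⟩
    rw [← h, Finset.mem_filter] at h1
    exact h1.2 (hq.himp_mem_of_le le_rfl)
  -- `η` is a uniform gap: `l a + η ≤ u b` whenever `a < b` in `D` modulo `q`.
  obtain ⟨η, hη, hηle⟩ := exists_pos_forall_le
    ((D ×ˢ D).filter fun z => z.2 ⇨ z.1 ∉ q) (fun z => (u z.2 : ℝ) - l z.1) fun z hz =>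
      sub_pos.2 (hlu' z.1 z.2 (Finset.mem_filter.1 hz).2)
  let N : ℝ := D.card + 1
  have hN : 0 < N := by positivity
  have r_le : ∀ a, η * (r a / N) < η := fun a => by
    have h1 : (r a : ℝ) ≤ D.card := by exact_mod_cast Finset.card_filter_le _ _
    have h2 : (r a : ℝ) / N < 1 := (div_lt_one hN).2 (by simp only [N]; linarith)
    nlinarith
  -- Raising `l` by a multiple of the rank makes it strictly increasing on `D`. Since `r a < N`, the
  -- increment stays below `η`, so truncating at `u` does not destroy strictness.
  let w : A → unitInterval := fun a => ⟨min (u a : ℝ) (l a + η * (r a / N)),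
    le_min (u a).2.1 (add_nonneg (l a).2.1 (by positivity)), (min_le_left _ _).trans (u a).2.2⟩
  have lw : ∀ a, l a ≤ w a := fun a => show (l a : ℝ) ≤ min (u a : ℝ) (l a + η * (r a / N)) from
    le_min (hlu a) (le_add_of_nonneg_right (by positivity))
  have wu : ∀ a, w a ≤ u a := fun a => show min (u a : ℝ) (l a + η * (r a / N)) ≤ u a from
    min_le_left _ _
  have w_mono : ∀ a b, a ⇨ b ∈ q → w a ≤ w b := fun a b hab => by
    change min (u a : ℝ) (l a + η * (r a / N)) ≤ min (u b : ℝ) (l b + η * (r b / N))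
    have h1 : (r a : ℝ) ≤ r b := by exact_mod_cast r_mono a b hab
    have h2 : (l a : ℝ) ≤ l b := l_mono a b hab
    exact min_le_min (u_mono a b hab) (by gcongr)
  have w_lt : ∀ a ∈ D, ∀ b ∈ D, b ⇨ a ∉ q → w a < w b := fun a ha b hb hab => by
    change min (u a : ℝ) (l a + η * (r a / N)) < min (u b : ℝ) (l b + η * (r b / N))
    have h1 : (r a : ℝ) < r b := by exact_mod_cast r_lt a b ha hab
    have h2 : (l a : ℝ) ≤ l b := l_mono a b ((hq.himp_mem_or a b).resolve_right hab)
    have h3 : η ≤ (u b : ℝ) - l a :=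
      hηle (a, b) (Finset.mem_filter.2 ⟨Finset.mem_product.2 ⟨ha, hb⟩, hab⟩)
    have h4 := r_le a
    refine (min_le_right _ _).trans_lt (lt_min (by linarith) ?_)
    have h5 : η * (r a / N) < η * (r b / N) := by gcongr
    linarith
  have hL : ∀ x ∈ L, x.2 ≤ w x.1 := fun x hx => le_trans
    (Finset.le_sup (f := Prod.snd)
      (Finset.mem_filter.2 ⟨hx, hq.himp_mem_of_le le_rfl⟩)) (lw x.1)
  have hU : ∀ y ∈ U, w y.1 ≤ y.2 := fun y hy => le_trans (wu y.1)
    (Finset.inf_le (f := Prod.snd) (Finset.mem_filter.2 ⟨hy, hq.himp_mem_of_le le_rfl⟩))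
  refine ⟨w, ⟨hbot, htop, le_antisymm (hU _ hUbot) bot_le, le_antisymm le_top (hL _ hLtop),
    fun {a b} ha hb => ⟨fun h => ?_, w_mono a b⟩⟩, hL, hU⟩
  by_contra hab
  exact absurd h (w_lt b hb a ha hab).not_ge

end Interpolation

/-! ### Embeddings preserve the Gödel operations. -/

section Valuations

theorem himp_eq_of_lt {a b : unitInterval} (h : b < a) : a ⇨ b = b := by
  refine le_antisymm ?_ le_himp
  have h1 : (a ⇨ b) ⊓ a ≤ b := himp_inf_le
  exact (inf_le_iff.1 h1).resolve_right h.not_ge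

namespace BimodalGodelAlgebra

theorem box_mono {A : Type*} [BimodalGodelAlgebra A] {a b : A} (h : a ≤ b) : box a ≤ box b := by
  rw [← inf_eq_left, ← box_inf, inf_eq_left.2 h]

theorem dia_mono {A : Type*} [BimodalGodelAlgebra A] {a b : A} (h : a ≤ b) : dia a ≤ dia b := by
  rw [← sup_eq_right, ← dia_sup, sup_eq_right.2 h]

end BimodalGodelAlgebra

open BimodalGodelAlgebra

namespace Realizes

variable {A : Type*} [BimodalGodelAlgebra A] {D : Finset A} {q : Set A} {v : A → unitInterval}

theorem mono (hv : Realizes D q v) (hq : IsPrimeFilter q) {a b : A} (ha : a ∈ D) (hb : b ∈ D)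
    (h : a ≤ b) : v a ≤ v b :=
  (hv.le_iff ha hb).2 (hq.himp_mem_of_le h)

theorem eq_one_iff (hv : Realizes D q v) {a : A} (ha : a ∈ D) :
    v a = 1 ↔ a ∈ q := by
  have h : (1 : unitInterval) ≤ v a ↔ a ∈ q := by
    rw [← hv.map_top, hv.le_iff hv.top_mem ha, top_himp]
  exact ⟨fun h1 => h.1 h1.ge, fun h1 => le_antisymm le_top (h.2 h1)⟩

theorem map_inf (hv : Realizes D q v) (hq : IsPrimeFilter q) {a b : A} (ha : a ∈ D) (hb : b ∈ D)
    (hab : a ⊓ b ∈ D) : v (a ⊓ b) = v a ⊓ v b := by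
  refine le_antisymm (le_inf (hv.mono hq hab ha inf_le_left) (hv.mono hq hab hb inf_le_right)) ?_
  rcases hq.himp_mem_or a b with h | h
  · exact inf_le_left.trans ((hv.le_iff ha hab).2 (by rwa [himp_inf_distrib, himp_self, top_inf_eq]))
  · exact inf_le_right.trans ((hv.le_iff hb hab).2 (by rwa [himp_inf_distrib, himp_self, inf_top_eq]))

theorem map_sup (hv : Realizes D q v) (hq : IsPrimeFilter q) {a b : A} (ha : a ∈ D) (hb : b ∈ D)
    (hab : a ⊔ b ∈ D) : v (a ⊔ b) = v a ⊔ v b := by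
  refine le_antisymm ?_ (sup_le (hv.mono hq ha hab le_sup_left) (hv.mono hq hb hab le_sup_right))
  rcases hq.himp_mem_or a b with h | h
  · exact le_sup_of_le_right
      ((hv.le_iff hab hb).2 (by rwa [sup_himp_distrib, himp_self, inf_top_eq]))
  · exact le_sup_of_le_left
      ((hv.le_iff hab ha).2 (by rwa [sup_himp_distrib, himp_self, top_inf_eq]))

theorem map_himp (hv : Realizes D q v) (hq : IsPrimeFilter q) {a b : A} (ha : a ∈ D) (hb : b ∈ D)
    (hab : a ⇨ b ∈ D) : v (a ⇨ b) = v a ⇨ v b := by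
  by_cases h : a ⇨ b ∈ q
  · rw [(hv.eq_one_iff hab).2 h, himp_eq_top_iff.2 ((hv.le_iff ha hb).2 h)]
    rfl
  · rw [himp_eq_of_lt (not_le.1 (mt (hv.le_iff ha hb).1 h))]
    exact le_antisymm ((hv.le_iff hab hb).2 (hq.himp_himp_mem h)) (hv.mono hq hb hab le_himp)

end Realizes

theorem exists_realizes {A : Type*} [BimodalGodelAlgebra A] {q : Set A}
    (hq : IsPrimeFilter q) (D : Finset A) (hbot : ⊥ ∈ D) (htop : ⊤ ∈ D) :
    ∃ w : A → unitInterval, Realizes D q w := by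
  classical
  obtain ⟨w, hw, -⟩ := exists_realizes_between hq D hbot htop {(⊥, 0), (⊤, 1)} {(⊥, 0), (⊤, 1)}
    (by simp) (by simp) (by simp) (by simp)
    (by simpa using hq.bot_notMem) (by simp [hq.top_mem])
  exact ⟨w, hw⟩

end Valuations

/-! ### Successor worlds witnessing the modal values. -/

section Successors

open BimodalGodelAlgebra

/-- The predicate `small` is a proper lower cut of the chain `A/p`. -/
theorem exists_successor {A : Type*} [BimodalGodelAlgebra A] {D Φ : Finset A}
    (hΦ : ∀ a ∈ Φ, a ∈ D ∧ box a ∈ D ∧ dia a ∈ D) {p q : Set A} (hp : IsPrimeFilter p)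
    (hq : IsPrimeFilter q) {v : A → unitInterval} (hv : Realizes D p v) (small : A → Prop)
    (small_le : ∀ a b, a ⇨ b ∈ p → small b → small a) (small_bot : small ⊥)
    (small_top : ¬ small ⊤) (hbox : ∀ a, ¬ small (box a) → a ∈ q)
    (hdia : ∀ a, small (dia a) → a ∉ q) {c : A} {γ : unitInterval} (hγ0 : 0 < γ)
    (hγ1 : c ∈ q → γ = 1) (hγ : ∀ a ∈ Φ, small (box a) → v (box a) < γ) :
    ∃ w, Realizes D q w ∧ (∀ a ∈ Φ, small (box a) → v (box a) ≤ w a) ∧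
      (∀ a ∈ Φ, small (dia a) → w a ≤ v (dia a)) ∧ w c ≤ γ := by
  classical
  have box_mem : ∀ a, box a ∈ p → a ∈ q := fun a ha =>
    hbox a fun h => small_top (small_le _ _ (by rwa [top_himp]) h)
  have dia_le_box : ∀ a b, dia a ⇨ box b ∈ p → a ⇨ b ∈ q := fun a b h =>
    box_mem _ (hp.mem_of_le (dia_himp_box_le a b) h)
  -- If `box a ⇨ dia b` were not in `p`, it would lie below `dia b` in the chain and hence be small.
  -- Then so would `dia (a ⇨ b)`, which forces `a ⇨ b ∉ q`.
  have box_le_dia : ∀ a b, small (dia b) → a ⇨ b ∈ q → box a ⇨ dia b ∈ p := fun a b hb h => by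
    by_contra hab
    exact hdia _ (small_le _ _ (hp.himp_mem_of_le (dia_himp_le a b))
      (small_le _ _ (hp.himp_himp_mem hab) hb)) h
  have hsm1 : ∀ a ∈ Φ, small (box a) → v (box a) < 1 := fun a ha h =>
    lt_of_le_of_ne le_top fun h1 => small_top (small_le _ _
      (by rwa [top_himp, ← hv.eq_one_iff (hΦ a ha).2.1]) h)
  let L : Finset (A × unitInterval) :=
    {(⊥, 0), (⊤, 1)} ∪ (Φ.filter fun a => small (box a)).image fun a => (a, v (box a))
  let U : Finset (A × unitInterval) :=
    {(⊥, 0), (⊤, 1), (c, γ)} ∪ (Φ.filter fun a => small (dia a)).image fun a => (a, v (dia a))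
  have hL : ∀ x ∈ L, x = (⊥, 0) ∨ x = (⊤, 1) ∨
      ∃ a ∈ Φ, small (box a) ∧ x = (a, v (box a)) := fun x hx => by
    simp only [L, Finset.mem_union, Finset.mem_insert, Finset.mem_singleton, Finset.mem_image,
      Finset.mem_filter] at hx
    rcases hx with (h | h) | ⟨a, h, rfl⟩
    exacts [.inl h, .inr (.inl h), .inr (.inr ⟨a, h.1, h.2, rfl⟩)]
  have hU : ∀ y ∈ U, y = (⊥, 0) ∨ y = (⊤, 1) ∨ y = (c, γ) ∨
      ∃ a ∈ Φ, small (dia a) ∧ y = (a, v (dia a)) := fun x hx => by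
    simp only [U, Finset.mem_union, Finset.mem_insert, Finset.mem_singleton, Finset.mem_image,
      Finset.mem_filter] at hx
    rcases hx with (h | h | h) | ⟨a, h, rfl⟩
    exacts [.inl h, .inr (.inl h), .inr (.inr (.inl h)), .inr (.inr (.inr ⟨a, h.1, h.2, rfl⟩))]
  -- Between box and dia bounds, weak compatibility is `box_le_dia` and strict compatibility is the
  -- contrapositive of `dia_le_box`. The remaining cases involve the endpoints or `(c, γ)`.
  obtain ⟨w, hw, hwL, hwU⟩ := exists_realizes_between hq D hv.bot_mem hv.top_mem L U
    (by simp [L]) (by simp [L]) (by simp [U]) (by simp [U])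
    (fun x hx y hy h => by
      rcases hL x hx with rfl | rfl | ⟨a, ha, hsa, rfl⟩
      · exact bot_le
      · have hyq : y.1 ∈ q := by simpa using h
        rcases hU y hy with rfl | rfl | rfl | ⟨b, hb, hsb, rfl⟩
        · exact absurd hyq hq.bot_notMem
        · exact le_rfl
        · exact (hγ1 hyq).ge
        · exact absurd hyq (hdia b hsb)
      · rcases hU y hy with rfl | rfl | rfl | ⟨b, hb, hsb, rfl⟩
        · have h1 := box_le_dia a ⊥ (by rwa [dia_bot]) h
          rw [dia_bot, ← hv.le_iff (hΦ a ha).2.1 hv.bot_mem, hv.map_bot] at h1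
          exact h1
        · exact le_top
        · exact (hγ a ha hsa).le
        · exact (hv.le_iff (hΦ a ha).2.1 (hΦ b hb).2.2).2 (box_le_dia a b hsb h))
    (fun x hx y hy h => by
      rcases hL x hx with rfl | rfl | ⟨a, ha, hsa, rfl⟩
      · rcases hU y hy with rfl | rfl | rfl | ⟨b, hb, hsb, rfl⟩
        · exact absurd (hq.himp_mem_of_le le_rfl) h
        · exact zero_lt_one
        · exact hγ0
        · refine lt_of_le_of_ne bot_le fun h1 => h (dia_le_box b ⊥ ?_)
          refine hp.himp_trans ((hv.le_iff (hΦ b hb).2.2 hv.bot_mem).1 ?_)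
            (hp.himp_mem_of_le bot_le)
          rw [hv.map_bot]
          exact h1.ge
      · exact absurd (hq.himp_mem_of_le le_top) h
      · rcases hU y hy with rfl | rfl | rfl | ⟨b, hb, hsb, rfl⟩
        · exact absurd (hq.himp_mem_of_le bot_le) h
        · exact hsm1 a ha hsa
        · exact hγ a ha hsa
        · refine not_le.1 fun h1 => h (dia_le_box b a ?_)
          exact (hv.le_iff (hΦ b hb).2.2 (hΦ a ha).2.1).1 h1)
  refine ⟨w, hw, fun a ha hs => hwL (a, v (box a)) ?_, fun a ha hs => hwU (a, v (dia a)) ?_,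
    hwU (c, γ) (by simp [U])⟩
  · exact Finset.mem_union_right _ (Finset.mem_image_of_mem _ (Finset.mem_filter.2 ⟨ha, hs⟩))
  · exact Finset.mem_union_right _ (Finset.mem_image_of_mem _ (Finset.mem_filter.2 ⟨ha, hs⟩))

/-- The canonical accessibility degree of `w` from `v` with respect to the elements of `Φ`. -/
noncomputable def accessibility {A : Type*} [BimodalGodelAlgebra A] (Φ : Finset A)
    (v w : A → unitInterval) : unitInterval :=
  Φ.inf fun a => (v (box a) ⇨ w a) ⊓ (w a ⇨ v (dia a))

/-- Choose `q` to contain every `a` with `box a > box c` in `A/p`, and to omit `c` and every `b`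
with `dia b ≤ box c`. The element `c` may have to sit strictly above `v (box c)`, because some `a <
c` in `A/q` can have `box a = box c` in `A/p`; hence the arbitrary slack up to `t`. -/
theorem exists_box_witness {A : Type*} [BimodalGodelAlgebra A] {D Φ : Finset A}
    (hΦ : ∀ a ∈ Φ, a ∈ D ∧ box a ∈ D ∧ dia a ∈ D) {p : Set A} (hp : IsPrimeFilter p)
    {v : A → unitInterval} (hv : Realizes D p v) {c : A} (hc : c ∈ Φ) {t : unitInterval}
    (ht : v (box c) < t) :
    ∃ q w, IsPrimeFilter q ∧ Realizes D q w ∧ (accessibility Φ v w ⇨ w c) < t := by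
  have hc1 : box c ∉ p := by
    rw [← hv.eq_one_iff (hΦ c hc).2.1]
    exact (ht.trans_le le_top).ne
  obtain ⟨q, hq, hQq, hJq⟩ := exists_primeFilter {a | box a ⇨ box c ∉ p}
    {a | ∃ b, dia b ⇨ box c ∈ p ∧ a ≤ b ⊔ c}
    (by rwa [Set.mem_ofPred_eq, box_top, top_himp])
    (fun a b hab ha hb => ha (hp.himp_trans (hp.himp_mem_of_le (box_mono hab)) hb))
    (fun a b ha hb h => by
      rw [box_inf] at h
      rcases hp.himp_mem_or (box a) (box b) with h1 | h1
      · refine ha (hp.himp_trans ?_ h)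
        rwa [himp_inf_distrib, himp_self, top_inf_eq]
      · refine hb (hp.himp_trans ?_ h)
        rwa [himp_inf_distrib, himp_self, inf_top_eq])
    ⟨⊥, by rw [dia_bot]; exact hp.himp_mem_of_le bot_le, bot_le⟩
    (fun a b hab ⟨d, hd, hb⟩ => ⟨d, hd, hab.trans hb⟩)
    (fun a b ⟨d, hd, ha⟩ ⟨e, he, hb⟩ => ⟨d ⊔ e, by
      rw [dia_sup, sup_himp_distrib]
      exact hp.inf_mem hd he, sup_le (ha.trans (sup_le_sup_right le_sup_left _))
        (hb.trans (sup_le_sup_right le_sup_right _))⟩)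
    -- From `dia b ≤ box c` the first mixed axiom gives `box (b ⇨ c) ∈ p`; as `a ⊓ (b ⇨ c) ≤ c`,
    -- this yields `box a ≤ box c` modulo `p`.
    (fun a ha ⟨b, hb, hab⟩ => ha <| by
      have h1 : box (b ⇨ c) ∈ p := hp.mem_of_le (dia_himp_box_le b c) hb
      refine hp.mem_of_le ?_ h1
      rw [le_himp_iff, ← box_inf]
      refine box_mono ((inf_le_inf_left _ hab).trans ?_)
      rw [inf_sup_left]
      exact sup_le himp_inf_le inf_le_right)
  have hcq : c ∉ q := hJq c ⟨⊥, by rw [dia_bot]; exact hp.himp_mem_of_le bot_le, le_sup_right⟩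
  -- Take `γ` so close above `v (box c)` that no value `v (dia a)` with `a ∈ Φ` lies in between.
  obtain ⟨γ, hγ, hγt, hγ1, hγΦ⟩ : ∃ γ, v (box c) < γ ∧ γ < t ∧ γ < 1 ∧
      ∀ a ∈ Φ, v (box c) < v (dia a) → γ < v (dia a) := by
    have : (nhdsWithin (v (box c)) (Set.Ioi (v (box c)))).NeBot :=
      nhdsGT_neBot_of_exists_gt ⟨t, ht⟩
    have h1 : ∀ s, v (box c) < s →
        ∀ᶠ γ in nhdsWithin (v (box c)) (Set.Ioi (v (box c))), γ < s :=
      fun s hs => nhdsWithin_le_nhds (eventually_lt_nhds hs)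
    have h2 : ∀ᶠ γ in nhdsWithin (v (box c)) (Set.Ioi (v (box c))),
        ∀ a ∈ Φ, v (box c) < v (dia a) → γ < v (dia a) :=
      (Filter.eventually_all_finset Φ).2 fun a _ => by
        by_cases h : v (box c) < v (dia a)
        · exact (h1 _ h).mono fun _ h' _ => h'
        · exact Filter.Eventually.of_forall fun _ h' => absurd h' h
    have h3 : ∀ᶠ γ in nhdsWithin (v (box c)) (Set.Ioi (v (box c))), v (box c) < γ :=
      self_mem_nhdsWithin
    obtain ⟨γ, h⟩ := ((h3.and (h1 t ht)).and
      ((h1 1 (ht.trans_le le_top)).and h2)).exists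
    exact ⟨γ, h.1.1, h.1.2, h.2.1, h.2.2⟩
  obtain ⟨w, hw, hwbox, hwdia, hwc⟩ := exists_successor hΦ hp hq hv (fun a => a ⇨ box c ∈ p)
    (fun a b h h' => hp.himp_trans h h') (hp.himp_mem_of_le bot_le) (by rwa [top_himp])
    (fun a h => hQq h) (fun a h => hJq a ⟨a, h, le_sup_left⟩) (bot_le.trans_lt hγ)
    (fun h => absurd h hcq)
    (fun a ha h => ((hv.le_iff (hΦ a ha).2.1 (hΦ c hc).2.1).2 h).trans_lt hγ)
  refine ⟨q, w, hq, hw, ?_⟩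
  -- The accessibility degree exceeds `w c`, so the residuum collapses to `w c ≤ γ < t`.
  rw [himp_eq_of_lt]
  · exact hwc.trans_lt hγt
  refine (Finset.lt_inf_iff (hwc.trans_lt hγ1)).2 fun a ha => lt_inf_iff.2 ⟨?_, ?_⟩
  · refine (hwc.trans_lt hγ1).trans_le (himp_eq_top_iff.2 ?_).ge
    by_cases h : box a ⇨ box c ∈ p
    · exact hwbox a ha h
    · rw [(hw.eq_one_iff (hΦ a ha).1).2 (hQq h)]
      exact le_top
  · by_cases h : dia a ⇨ box c ∈ p
    · exact (hwc.trans_lt hγ1).trans_le (himp_eq_top_iff.2 (hwdia a ha h)).ge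
    · refine (hwc.trans_lt (hγΦ a ha ?_)).trans_le le_himp
      rwa [← not_le, hv.le_iff (hΦ a ha).2.2 (hΦ c hc).2.1]

/-- Choose `q` to contain `c` and every `b` with `dia c ≤ box b` in `A/p`, and to omit every `a`
with `dia a < dia c`. Then `w c = 1`, so only accessibility has to reach `v (dia c)`. Positivity of
`v (dia c)` puts `⊥` strictly below the cut. -/
theorem exists_dia_witness {A : Type*} [BimodalGodelAlgebra A] {D Φ : Finset A}
    (hΦ : ∀ a ∈ Φ, a ∈ D ∧ box a ∈ D ∧ dia a ∈ D) {p : Set A} (hp : IsPrimeFilter p)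
    {v : A → unitInterval} (hv : Realizes D p v) {c : A} (hc : c ∈ Φ) (h0 : 0 < v (dia c)) :
    ∃ q w, IsPrimeFilter q ∧ Realizes D q w ∧ v (dia c) ≤ accessibility Φ v w ⊓ w c := by
  have hc0 : dia c ⇨ ⊥ ∉ p := by
    rw [← hv.le_iff (hΦ c hc).2.2 hv.bot_mem, hv.map_bot]
    exact h0.not_ge
  obtain ⟨q, hq, hQq, hJq⟩ := exists_primeFilter {a | ∃ b, dia c ⇨ box b ∈ p ∧ b ⊓ c ≤ a}
    {a | dia c ⇨ dia a ∉ p}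
    ⟨⊤, by rw [box_top]; exact hp.himp_mem_of_le le_top, le_top⟩
    (fun a b hab ⟨d, hd, ha⟩ => ⟨d, hd, ha.trans hab⟩)
    (fun a b ⟨d, hd, ha⟩ ⟨e, he, hb⟩ => ⟨d ⊓ e, by
      rw [box_inf, himp_inf_distrib]
      exact hp.inf_mem hd he, le_inf ((inf_le_inf_right _ inf_le_left).trans ha)
        ((inf_le_inf_right _ inf_le_right).trans hb)⟩)
    (by rwa [Set.mem_ofPred_eq, dia_bot])
    (fun a b hab hb ha => hb (hp.himp_trans ha (hp.himp_mem_of_le (dia_mono hab))))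
    (fun a b ha hb h => by
      rw [dia_sup] at h
      rcases hp.himp_mem_or (dia a) (dia b) with h1 | h1
      · refine hb (hp.himp_trans h ?_)
        rwa [sup_himp_distrib, himp_self, inf_top_eq]
      · refine ha (hp.himp_trans h ?_)
        rwa [sup_himp_distrib, himp_self, top_inf_eq])
    -- From `c ≤ b ⇨ a` the second mixed axiom gives `dia c ≤ box b ⇨ dia a`; combine this with `dia
    -- c ≤ box b` modulo `p`.
    (fun a ⟨b, hb, hba⟩ ha => ha <| by
      refine hp.mem_of_le ?_ hb
      rw [le_himp_iff]
      have h1 : dia c ≤ box b ⇨ dia a :=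
        (dia_mono (by rwa [le_himp_iff, inf_comm])).trans (dia_himp_le b a)
      exact (le_inf (inf_le_right.trans h1) himp_inf_le).trans himp_inf_le)
  have hcq : c ∈ q := hQq ⟨⊤, by rw [box_top]; exact hp.himp_mem_of_le le_top, inf_le_right⟩
  have hQ : ∀ a, dia c ⇨ box a ∈ p → a ∈ q := fun a h => hQq ⟨a, h, inf_le_left⟩
  -- The cut consists of the elements strictly below `dia c`; with `γ = 1` the bound on `c` is
  -- vacuous.
  obtain ⟨w, hw, hwbox, hwdia, -⟩ := exists_successor hΦ hp hq hv (fun a => dia c ⇨ a ∉ p)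
    (fun a b h h' h'' => h' (hp.himp_trans h'' h)) hc0
    (fun h => h (hp.himp_mem_of_le le_top)) (fun a h => hQ a (not_not.1 h))
    (fun a h => hJq a h) (zero_lt_one (α := unitInterval)) (c := c) (fun _ => rfl)
    (fun a ha h => lt_of_lt_of_le (not_le.1 (mt (hv.le_iff (hΦ c hc).2.2 (hΦ a ha).2.1).1 h))
      le_top)
  refine ⟨q, w, hq, hw, le_inf (Finset.le_inf fun a ha => le_inf ?_ ?_) ?_⟩
  · refine le_of_le_of_eq le_top (himp_eq_top_iff.2 ?_).symm
    by_cases h : dia c ⇨ box a ∈ p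
    · rw [(hw.eq_one_iff (hΦ a ha).1).2 (hQ a h)]
      exact le_top
    · exact hwbox a ha h
  · by_cases h : dia c ⇨ dia a ∈ p
    · exact ((hv.le_iff (hΦ c hc).2.2 (hΦ a ha).2.2).2 h).trans le_himp
    · exact le_of_le_of_eq le_top (himp_eq_top_iff.2 (hwdia a ha h)).symm
  · rw [(hw.eq_one_iff (hΦ c hc).1).2 hcq]
    exact le_top

end Successors

/-! ### The canonical frame and its modal operations. -/

section CanonicalFrame

open BimodalGodelAlgebra

open Classical in
/-- A finite set together with the results of applying one modal operation to its elements. -/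
noncomputable def modalHull {A : Type*} [BimodalGodelAlgebra A] (F : Finset A) : Finset A :=
  F ∪ F.image box ∪ F.image dia

theorem subset_modalHull {A : Type*} [BimodalGodelAlgebra A] {F : Finset A} {a : A} (h : a ∈ F) :
    a ∈ modalHull F := by
  classical exact Finset.mem_union_left _ (Finset.mem_union_left _ h)

theorem box_mem_modalHull {A : Type*} [BimodalGodelAlgebra A] {F : Finset A} {a : A}
    (h : a ∈ F) : box a ∈ modalHull F := by
  classical exact Finset.mem_union_left _ (Finset.mem_union_right _ (Finset.mem_image_of_mem _ h))

theorem dia_mem_modalHull {A : Type*} [BimodalGodelAlgebra A] {F : Finset A} {a : A}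
    (h : a ∈ F) : dia a ∈ modalHull F := by
  classical exact Finset.mem_union_right _ (Finset.mem_image_of_mem _ h)

open Classical in
/-- The elements of the algebra on which canonical worlds are required to be faithful. -/
noncomputable def canonicalDomain {A : Type*} [BimodalGodelAlgebra A] (F : Finset A) : Finset A :=
  insert ⊥ (insert ⊤ (modalHull (modalHull F)))

theorem mem_canonicalDomain {A : Type*} [BimodalGodelAlgebra A] {F : Finset A} {a : A}
    (h : a ∈ modalHull (modalHull F)) : a ∈ canonicalDomain F := by
  classical exact Finset.mem_insert_of_mem (Finset.mem_insert_of_mem h)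

/-- This is why the domain takes two hulls: witnesses are built with `Φ = modalHull F`, whose modal
images must also be faithfully represented. -/
theorem modalHull_closed {A : Type*} [BimodalGodelAlgebra A] {F : Finset A} :
    ∀ a ∈ modalHull F, a ∈ canonicalDomain F ∧ box a ∈ canonicalDomain F ∧
      dia a ∈ canonicalDomain F := fun _ ha =>
  ⟨mem_canonicalDomain (subset_modalHull ha), mem_canonicalDomain (box_mem_modalHull ha),
    mem_canonicalDomain (dia_mem_modalHull ha)⟩

/-- The worlds of the canonical frame of a finite set `F` of elements. -/
def CanonicalWorld {A : Type u} [BimodalGodelAlgebra A] (F : Finset A) : Type u :=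
  {v : A → unitInterval // ∃ q, IsPrimeFilter q ∧ Realizes (canonicalDomain F) q v}

/-- The degree to which the modal values over `F` are inherited along an accessibility step. -/
noncomputable def inheritance {A : Type*} [BimodalGodelAlgebra A] (F : Finset A)
    (v w : A → unitInterval) : unitInterval :=
  F.inf fun a => (v (box a) ⇨ w (box a)) ⊓ (w (dia a) ⇨ v (dia a))

/-- The canonical accessibility, restricted in the presence of transitivity. -/
noncomputable def forwardAccessibility {A : Type*} [BimodalGodelAlgebra A]
    (P : Set ModalProperty) (F : Finset A) (v w : A → unitInterval) : unitInterval :=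
  accessibility F v w ⊓ ⨅ _ : ModalProperty.transitivity ∈ P, inheritance F v w

/-- The canonical frame for a set of modal properties and a finite set of elements. -/
noncomputable def canonicalFrame {A : Type u} [BimodalGodelAlgebra A] (P : Set ModalProperty)
    (F : Finset A) [Nonempty (CanonicalWorld F)] : GKFrame.{u} where
  World := CanonicalWorld F
  S v w := forwardAccessibility P F v.1 w.1 ⊓
    ⨅ _ : ModalProperty.symmetry ∈ P, forwardAccessibility P F w.1 v.1

theorem himp_inf_himp_le {H : Type*} [HeytingAlgebra H] {a b c x y : H} (hx : x ≤ a ⇨ b)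
    (hy : y ≤ b ⇨ c) : x ⊓ y ≤ a ⇨ c := by
  rw [le_himp_iff]
  exact (le_inf (inf_le_left.trans (inf_le_right.trans hy))
    ((inf_le_inf_right _ (inf_le_left.trans hx)).trans himp_inf_le)).trans himp_inf_le

theorem accessibility_le_box {A : Type*} [BimodalGodelAlgebra A] {F : Finset A} {a : A}
    (ha : a ∈ F) (v w : A → unitInterval) : accessibility F v w ≤ v (box a) ⇨ w a :=
  (Finset.inf_le ha).trans inf_le_left

theorem accessibility_le_dia {A : Type*} [BimodalGodelAlgebra A] {F : Finset A} {a : A}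
    (ha : a ∈ F) (v w : A → unitInterval) : accessibility F v w ≤ w a ⇨ v (dia a) :=
  (Finset.inf_le ha).trans inf_le_right

theorem inheritance_le_box {A : Type*} [BimodalGodelAlgebra A] {F : Finset A} {a : A}
    (ha : a ∈ F) (v w : A → unitInterval) : inheritance F v w ≤ v (box a) ⇨ w (box a) :=
  (Finset.inf_le ha).trans inf_le_left

theorem inheritance_le_dia {A : Type*} [BimodalGodelAlgebra A] {F : Finset A} {a : A}
    (ha : a ∈ F) (v w : A → unitInterval) : inheritance F v w ≤ w (dia a) ⇨ v (dia a) :=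
  (Finset.inf_le ha).trans inf_le_right

/-- Inheritance carries `box a` from `v` to `w`, and accessibility then passes to `a` at `z`; the
`dia` conditions compose in the reverse direction. Inheritance itself is transitive. -/
theorem forwardAccessibility_trans {A : Type*} [BimodalGodelAlgebra A] {P : Set ModalProperty}
    (hP : ModalProperty.transitivity ∈ P) (F : Finset A) (v w z : A → unitInterval) :
    forwardAccessibility P F v w ⊓ forwardAccessibility P F w z ≤
      forwardAccessibility P F v z := by
  simp only [forwardAccessibility, hP, iInf_pos]
  refine le_inf (Finset.le_inf fun a ha => le_inf ?_ ?_)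
    (Finset.le_inf fun a ha => le_inf ?_ ?_)
  · exact himp_inf_himp_le (inf_le_right.trans (inheritance_le_box ha v w))
      (inf_le_left.trans (accessibility_le_box ha w z))
  · rw [inf_comm]
    exact himp_inf_himp_le (inf_le_left.trans (accessibility_le_dia ha w z))
      (inf_le_right.trans (inheritance_le_dia ha v w))
  · exact himp_inf_himp_le (inf_le_right.trans (inheritance_le_box ha v w))
      (inf_le_right.trans (inheritance_le_box ha w z))
  · rw [inf_comm]
    exact himp_inf_himp_le (inf_le_right.trans (inheritance_le_dia ha w z))
      (inf_le_right.trans (inheritance_le_dia ha v w))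

/-- Only reflexivity draws on the identities; transitivity and symmetry hold by the construction of
`S`. -/
theorem canonicalFrame_has {A : BimodalGodelAlg.{u}} {P : Set ModalProperty}
    (hA : A ∈ modalSubvariety P) (F : Finset A.carrier) [Nonempty (CanonicalWorld F)] :
    ∀ p ∈ P, (canonicalFrame P F).Has p := by
  intro p hp
  cases p with
  | reflexivity =>
    rintro ⟨v, q, hq, hv⟩
    have hr := hA _ hp
    have h1 : accessibility F v v = ⊤ := top_le_iff.1 <| Finset.le_inf fun a ha => by
      obtain ⟨h1, h2, h3⟩ := modalHull_closed a (subset_modalHull ha)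
      rw [himp_eq_top_iff.2 (hv.mono hq h2 h1 (hr.1 a)),
        himp_eq_top_iff.2 (hv.mono hq h1 h3 (hr.2 a)), inf_top_eq]
    have h2 : inheritance F v v = ⊤ := top_le_iff.1 <| Finset.le_inf fun a ha => by
      rw [himp_self, himp_self, inf_top_eq]
    change forwardAccessibility P F v v ⊓ ⨅ _ : _, forwardAccessibility P F v v = ⊤
    simp only [forwardAccessibility, h1, h2, iInf_top, inf_top_eq]
  | transitivity =>
    intro x y z
    refine le_inf ((inf_le_inf inf_le_left inf_le_left).trans
      (forwardAccessibility_trans hp F x.1 y.1 z.1)) (le_iInf fun hs => ?_)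
    refine (inf_le_inf (inf_le_right.trans (iInf_le _ hs))
      (inf_le_right.trans (iInf_le _ hs))).trans ?_
    rw [inf_comm]
    exact forwardAccessibility_trans hp F z.1 y.1 x.1
  | symmetry =>
    intro x y
    simp only [canonicalFrame, hp, iInf_pos]
    exact inf_comm _ _

/-- In the algebras of the subvariety the restrictions on canonical accessibility follow from
accessibility with respect to a larger set of elements. -/
theorem accessibility_modalHull_le {A : BimodalGodelAlg.{u}} {P : Set ModalProperty}
    (hA : A ∈ modalSubvariety P) (F : Finset A.carrier) [Nonempty (CanonicalWorld F)]
    (v w : (canonicalFrame P F).World) :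
    accessibility (modalHull F) v.1 w.1 ≤ (canonicalFrame P F).S v w := by
  obtain ⟨v, p, hp, hv⟩ := v
  obtain ⟨w, q, hq, hw⟩ := w
  change accessibility (modalHull F) v w ≤
    forwardAccessibility P F v w ⊓ ⨅ _ : _, forwardAccessibility P F w v
  set X := accessibility (modalHull F) v w
  have hbox : ∀ a ∈ modalHull F, X ≤ v (box a) ⇨ w a := fun a ha => accessibility_le_box ha v w
  have hdia : ∀ a ∈ modalHull F, X ≤ w a ⇨ v (dia a) := fun a ha => accessibility_le_dia ha v w
  have D0 : ∀ a ∈ modalHull F, a ∈ canonicalDomain F := fun a ha => (modalHull_closed a ha).1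
  have Db : ∀ a ∈ modalHull F, box a ∈ canonicalDomain F := fun a ha => (modalHull_closed a ha).2.1
  have Dd : ∀ a ∈ modalHull F, dia a ∈ canonicalDomain F := fun a ha => (modalHull_closed a ha).2.2
  have F0 : ∀ a ∈ F, a ∈ modalHull F := fun a ha => subset_modalHull ha
  have Fb : ∀ a ∈ F, box a ∈ modalHull F := fun a ha => box_mem_modalHull ha
  have Fd : ∀ a ∈ F, dia a ∈ modalHull F := fun a ha => dia_mem_modalHull ha
  refine le_inf (le_inf ?_ (le_iInf fun ht => ?_)) (le_iInf fun hs => le_inf ?_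
    (le_iInf fun ht => ?_)) <;> refine Finset.le_inf fun a ha => le_inf ?_ ?_
  · exact hbox a (F0 a ha)
  · exact hdia a (F0 a ha)
  -- Inheritance is accessibility at `box a` and `dia a`, after `box a ≤ box (box a)` and `dia (dia
  -- a) ≤ dia a`.
  · exact (hbox _ (Fb a ha)).trans (himp_le_himp_right
      (hv.mono hp (D0 _ (Fb a ha)) (Db _ (Fb a ha)) ((hA _ ht).1 a)))
  · exact (hdia _ (Fd a ha)).trans (himp_le_himp_left
      (hv.mono hp (Dd _ (Fd a ha)) (D0 _ (Fd a ha)) ((hA _ ht).2 a)))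
  -- Backward accessibility swaps the roles: the `dia` condition at `box a` with `dia (box a) ≤ a`,
  -- and the `box` condition at `dia a` with `a ≤ box (dia a)`.
  · exact (hdia _ (Fb a ha)).trans (himp_le_himp_left
      (hv.mono hp (Dd _ (Fb a ha)) (D0 _ (F0 a ha)) ((hA _ hs).2 a)))
  · exact (hbox _ (Fd a ha)).trans (himp_le_himp_right
      (hv.mono hp (D0 _ (F0 a ha)) (Db _ (Fd a ha)) ((hA _ hs).1 a)))
  -- Backward inheritance needs both pairs: `dia (box a) ≤ dia (box (box a)) ≤ box a`, and dually.
  · exact (hdia _ (Fb a ha)).trans (himp_le_himp_left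
      (hv.mono hp (Dd _ (Fb a ha)) (D0 _ (Fb a ha))
        ((dia_mono ((hA _ ht).1 a)).trans ((hA _ hs).2 (box a)))))
  · exact (hbox _ (Fd a ha)).trans (himp_le_himp_right
      (hv.mono hp (D0 _ (Fd a ha)) (Db _ (Fd a ha))
        (((hA _ hs).1 (dia a)).trans (box_mono ((hA _ ht).2 a)))))

theorem canonicalFrame_S_le {A : Type u} [BimodalGodelAlgebra A] {P : Set ModalProperty}
    {F : Finset A} [Nonempty (CanonicalWorld F)] (v w : (canonicalFrame P F).World) :
    (canonicalFrame P F).S v w ≤ accessibility F v.1 w.1 :=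
  inf_le_left.trans inf_le_left

/-- `S` is squeezed between accessibility over `modalHull F` and over `F`. The lower bound transfers
the witnesses; the upper bound gives the other inequality. -/
theorem canonicalFrame_box {A : BimodalGodelAlg.{u}} {P : Set ModalProperty}
    (hA : A ∈ modalSubvariety P) (F : Finset A.carrier) [Nonempty (CanonicalWorld F)]
    (v : (canonicalFrame P F).World) {a : A.carrier} (ha : a ∈ F) :
    ⨅ w : (canonicalFrame P F).World, ((canonicalFrame P F).S v w ⇨ w.1 a) = v.1 (box a) := by
  refine le_antisymm (le_of_forall_gt fun t ht => ?_) (le_iInf fun w => ?_)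
  · obtain ⟨p, hp, hv⟩ := v.2
    obtain ⟨q, w, hq, hw, h⟩ :=
      exists_box_witness modalHull_closed hp hv (subset_modalHull ha) ht
    exact ((iInf_le _ (⟨w, q, hq, hw⟩ : (canonicalFrame P F).World)).trans
      (himp_le_himp_right (accessibility_modalHull_le hA F v ⟨w, q, hq, hw⟩))).trans_lt h
  · rw [le_himp_comm]
    exact (canonicalFrame_S_le v w).trans (accessibility_le_box ha v.1 w.1)

theorem canonicalFrame_dia {A : BimodalGodelAlg.{u}} {P : Set ModalProperty}
    (hA : A ∈ modalSubvariety P) (F : Finset A.carrier) [Nonempty (CanonicalWorld F)]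
    (v : (canonicalFrame P F).World) {a : A.carrier} (ha : a ∈ F) :
    ⨆ w : (canonicalFrame P F).World, ((canonicalFrame P F).S v w ⊓ w.1 a) = v.1 (dia a) := by
  refine le_antisymm (iSup_le fun w => ?_) ?_
  · rw [← le_himp_iff]
    exact (canonicalFrame_S_le v w).trans (accessibility_le_dia ha v.1 w.1)
  · obtain ⟨p, hp, hv⟩ := v.2
    rcases eq_or_lt_of_le (bot_le : (0 : unitInterval) ≤ v.1 (dia a)) with h0 | h0
    · rw [← h0]
      exact bot_le
    obtain ⟨q, w, hq, hw, h⟩ :=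
      exists_dia_witness modalHull_closed hp hv (subset_modalHull ha) h0
    exact (h.trans (inf_le_inf_right _
      (accessibility_modalHull_le hA F v ⟨w, q, hq, hw⟩))).trans
      (le_iSup (fun w : (canonicalFrame P F).World => (canonicalFrame P F).S v w ⊓ w.1 a)
        ⟨w, q, hq, hw⟩)

/-- The valuation of the canonical frame: the value of `a` at a world `v` is `v a`. -/
def canonicalValuation {A : Type u} [BimodalGodelAlgebra A] (P : Set ModalProperty)
    (F : Finset A) [Nonempty (CanonicalWorld F)] (a : A) : (canonicalFrame P F).Complex :=
  fun v => v.1 a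

end CanonicalFrame

/-! ### Terms, the truth lemma and separation of equations. -/

section Terms

open BimodalGodelAlgebra

/-- Terms of the language of bi-modal Gödel algebras. -/
inductive BimodalTerm (X : Type u) : Type u
  | var : X → BimodalTerm X
  | bot : BimodalTerm X
  | inf : BimodalTerm X → BimodalTerm X → BimodalTerm X
  | sup : BimodalTerm X → BimodalTerm X → BimodalTerm X
  | himp : BimodalTerm X → BimodalTerm X → BimodalTerm X
  | box : BimodalTerm X → BimodalTerm X
  | dia : BimodalTerm X → BimodalTerm X

namespace BimodalTerm

/-- The value of a term under an assignment. -/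
def eval {X : Type u} {B : Type*} [BimodalGodelAlgebra B] (e : X → B) : BimodalTerm X → B
  | var x => e x
  | bot => ⊥
  | inf s t => s.eval e ⊓ t.eval e
  | sup s t => s.eval e ⊔ t.eval e
  | himp s t => s.eval e ⇨ t.eval e
  | box s => BimodalGodelAlgebra.box (s.eval e)
  | dia s => BimodalGodelAlgebra.dia (s.eval e)

open Classical in
/-- The values of the subterms of a term. -/
noncomputable def values {X : Type u} {B : Type*} [BimodalGodelAlgebra B] (e : X → B) :
    BimodalTerm X → Finset B
  | var x => {e x}
  | bot => {⊥}
  | inf s t => insert (s.eval e ⊓ t.eval e) (s.values e ∪ t.values e)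
  | sup s t => insert (s.eval e ⊔ t.eval e) (s.values e ∪ t.values e)
  | himp s t => insert (s.eval e ⇨ t.eval e) (s.values e ∪ t.values e)
  | box s => insert (BimodalGodelAlgebra.box (s.eval e)) (s.values e)
  | dia s => insert (BimodalGodelAlgebra.dia (s.eval e)) (s.values e)

theorem eval_mem_values {X : Type u} {B : Type*} [BimodalGodelAlgebra B] (e : X → B)
    (t : BimodalTerm X) : t.eval e ∈ t.values e := by
  cases t <;> simp [eval, values]

/-- The truth lemma for the canonical frame. -/
theorem eval_canonicalFrame {A : BimodalGodelAlg.{u}} {P : Set ModalProperty}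
    (hA : A ∈ modalSubvariety P) (F : Finset A.carrier) [Nonempty (CanonicalWorld F)]
    {X : Type u} (e : X → A.carrier) (t : BimodalTerm X) (ht : t.values e ⊆ F) :
    t.eval (fun x => canonicalValuation P F (e x)) = canonicalValuation P F (t.eval e) := by
  classical
  have hD : ∀ a ∈ F, a ∈ canonicalDomain F := fun a ha =>
    mem_canonicalDomain (subset_modalHull (subset_modalHull ha))
  have hmem : t.eval e ∈ F := ht (t.eval_mem_values e)
  induction t with
  | var x => rfl
  | bot =>
    funext v
    obtain ⟨q, hq, hv⟩ := v.2
    exact hv.map_bot.symm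
  | inf s t hs ht' =>
    rw [values, Finset.insert_subset_iff, Finset.union_subset_iff] at ht
    have h1 := ht.2.1 (s.eval_mem_values e)
    have h2 := ht.2.2 (t.eval_mem_values e)
    rw [eval, hs ht.2.1 h1, ht' ht.2.2 h2]
    funext v
    obtain ⟨q, hq, hv⟩ := v.2
    exact (hv.map_inf hq (hD _ h1) (hD _ h2) (hD _ hmem)).symm
  | sup s t hs ht' =>
    rw [values, Finset.insert_subset_iff, Finset.union_subset_iff] at ht
    have h1 := ht.2.1 (s.eval_mem_values e)
    have h2 := ht.2.2 (t.eval_mem_values e)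
    rw [eval, hs ht.2.1 h1, ht' ht.2.2 h2]
    funext v
    obtain ⟨q, hq, hv⟩ := v.2
    exact (hv.map_sup hq (hD _ h1) (hD _ h2) (hD _ hmem)).symm
  | himp s t hs ht' =>
    rw [values, Finset.insert_subset_iff, Finset.union_subset_iff] at ht
    have h1 := ht.2.1 (s.eval_mem_values e)
    have h2 := ht.2.2 (t.eval_mem_values e)
    rw [eval, hs ht.2.1 h1, ht' ht.2.2 h2]
    funext v
    obtain ⟨q, hq, hv⟩ := v.2
    exact (hv.map_himp hq (hD _ h1) (hD _ h2) (hD _ hmem)).symm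
  | box s hs =>
    rw [values, Finset.insert_subset_iff] at ht
    have h1 := ht.2 (s.eval_mem_values e)
    rw [eval, hs ht.2 h1]
    funext v
    exact canonicalFrame_box hA F v h1
  | dia s hs =>
    rw [values, Finset.insert_subset_iff] at ht
    have h1 := ht.2 (s.eval_mem_values e)
    rw [eval, hs ht.2 h1]
    funext v
    exact canonicalFrame_dia hA F v h1

/-- Terms with different values in an algebra of the subvariety are separated by the complex
algebra of a frame with the corresponding properties. -/
theorem exists_frame_separating {A : BimodalGodelAlg.{u}} {P : Set ModalProperty}
    (hA : A ∈ modalSubvariety P) {X : Type u} (e : X → A.carrier) {s t : BimodalTerm X}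
    (hst : s.eval e ≠ t.eval e) :
    ∃ (G : GKFrame.{u}) (f : X → G.Complex), (∀ p ∈ P, G.Has p) ∧ s.eval f ≠ t.eval f := by
  classical
  wlog hle : ¬ s.eval e ≤ t.eval e generalizing s t with H
  · obtain ⟨G, f, hG, hf⟩ := H hst.symm fun h => hst (le_antisymm (not_not.1 hle) h)
    exact ⟨G, f, hG, hf.symm⟩
  -- A prime filter omitting `s ⇨ t` gives a world where the value of `s` exceeds that of `t`.
  obtain ⟨q, hq, -, hJ⟩ := exists_primeFilter {⊤} (Set.Iic (s.eval e ⇨ t.eval e)) rfl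
    (fun a b hab ha => top_le_iff.1 (by rwa [← Set.mem_singleton_iff.1 ha]))
    (fun a b ha hb => by
      rw [Set.mem_singleton_iff.1 ha, Set.mem_singleton_iff.1 hb, inf_top_eq]
      rfl)
    bot_le (fun a b hab hb => hab.trans hb) (fun a b ha hb => sup_le ha hb)
    (fun a ha h => hle (himp_eq_top_iff.1 (top_le_iff.1 (by
      rwa [Set.mem_singleton_iff.1 ha] at h))))
  let F : Finset A.carrier := s.values e ∪ t.values e
  obtain ⟨v, hv⟩ := exists_realizes hq (canonicalDomain F) (Finset.mem_insert_self _ _)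
    (Finset.mem_insert_of_mem (Finset.mem_insert_self _ _))
  let v' : CanonicalWorld F := ⟨v, q, hq, hv⟩
  have : Nonempty (CanonicalWorld F) := ⟨v'⟩
  refine ⟨canonicalFrame P F, fun x => canonicalValuation P F (e x), canonicalFrame_has hA F, fun h => ?_⟩
  rw [eval_canonicalFrame hA F e s Finset.subset_union_left,
    eval_canonicalFrame hA F e t Finset.subset_union_right] at h
  have h1 : v (s.eval e) = v (t.eval e) := congrFun h v'
  have hD : ∀ a ∈ F, a ∈ canonicalDomain F := fun a ha =>
    mem_canonicalDomain (subset_modalHull (subset_modalHull ha))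
  exact hJ _ le_rfl ((hv.le_iff (hD _ (Finset.mem_union_left _ (s.eval_mem_values e)))
    (hD _ (Finset.mem_union_right _ (t.eval_mem_values e)))).1 h1.le)

end BimodalTerm

end Terms

/-! ### Varieties and separation of equations, by generated subalgebras of products. -/

section Generation

namespace BimodalTerm

theorem eval_pi {X : Type u} {ι : Type*} {B : ι → Type*} [∀ i, BimodalGodelAlgebra (B i)]
    (f : ∀ i, X → B i) (t : BimodalTerm X) :
    t.eval (fun x i => f i x) = fun i => t.eval (f i) := by
  induction t with
  | var x => rfl
  | bot => rfl
  | inf s t hs ht => rw [eval, hs, ht]; rfl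
  | sup s t hs ht => rw [eval, hs, ht]; rfl
  | himp s t hs ht => rw [eval, hs, ht]; rfl
  | box s hs => rw [eval, hs]; rfl
  | dia s hs => rw [eval, hs]; rfl

end BimodalTerm

/-- The subalgebra generated by a family of elements: the set of values of terms. -/
def GeneratedSubalgebra {X : Type u} {B : Type*} [BimodalGodelAlgebra B] (e : X → B) :=
  {b : B // ∃ t : BimodalTerm X, t.eval e = b}

namespace GeneratedSubalgebra

variable {X : Type u} {B : Type*} [BimodalGodelAlgebra B] (e : X → B)

instance : LE (GeneratedSubalgebra e) := ⟨fun a b => a.1 ≤ b.1⟩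

instance : LT (GeneratedSubalgebra e) := ⟨fun a b => a.1 < b.1⟩

instance : Max (GeneratedSubalgebra e) :=
  ⟨fun a b => ⟨a.1 ⊔ b.1, a.2.elim fun s hs => b.2.elim fun t ht =>
    ⟨.sup s t, by rw [BimodalTerm.eval, hs, ht]⟩⟩⟩

instance : Min (GeneratedSubalgebra e) :=
  ⟨fun a b => ⟨a.1 ⊓ b.1, a.2.elim fun s hs => b.2.elim fun t ht =>
    ⟨.inf s t, by rw [BimodalTerm.eval, hs, ht]⟩⟩⟩

instance : HImp (GeneratedSubalgebra e) :=
  ⟨fun a b => ⟨a.1 ⇨ b.1, a.2.elim fun s hs => b.2.elim fun t ht =>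
    ⟨.himp s t, by rw [BimodalTerm.eval, hs, ht]⟩⟩⟩

instance : Compl (GeneratedSubalgebra e) :=
  ⟨fun a => ⟨a.1ᶜ, a.2.elim fun s hs => ⟨.himp s .bot, by
    rw [BimodalTerm.eval, hs, BimodalTerm.eval, himp_bot]⟩⟩⟩

instance : Bot (GeneratedSubalgebra e) := ⟨⟨⊥, .bot, rfl⟩⟩

instance : Top (GeneratedSubalgebra e) :=
  ⟨⟨⊤, .himp .bot .bot, by rw [BimodalTerm.eval, himp_self]⟩⟩

instance : HeytingAlgebra (GeneratedSubalgebra e) :=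
  Function.Injective.heytingAlgebra (fun a : GeneratedSubalgebra e => a.1)
    (fun _ _ => Subtype.ext) Iff.rfl Iff.rfl (fun _ _ => rfl) (fun _ _ => rfl) rfl rfl
    (fun _ => rfl) (fun _ _ => rfl)

instance : BimodalGodelAlgebra (GeneratedSubalgebra e) where
  box a := ⟨box a.1, a.2.elim fun s hs => ⟨.box s, by rw [BimodalTerm.eval, hs]⟩⟩
  dia a := ⟨dia a.1, a.2.elim fun s hs => ⟨.dia s, by rw [BimodalTerm.eval, hs]⟩⟩
  prelinear a b := Subtype.ext (BimodalGodelAlgebra.prelinear a.1 b.1)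
  box_inf a b := Subtype.ext (BimodalGodelAlgebra.box_inf a.1 b.1)
  dia_sup a b := Subtype.ext (BimodalGodelAlgebra.dia_sup a.1 b.1)
  box_top := Subtype.ext BimodalGodelAlgebra.box_top
  dia_bot := Subtype.ext BimodalGodelAlgebra.dia_bot
  dia_himp_box_le a b := BimodalGodelAlgebra.dia_himp_box_le a.1 b.1
  dia_himp_le a b := BimodalGodelAlgebra.dia_himp_le a.1 b.1

/-- The inclusion of a generated subalgebra. -/
def inclusion : BimodalGodelHom (GeneratedSubalgebra e) B where
  toFun a := a.1
  map_sup' _ _ := rfl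
  map_inf' _ _ := rfl
  map_bot' := rfl
  map_himp' _ _ := rfl
  map_box _ := rfl
  map_dia _ := rfl

/-- If the equations between terms that hold for `e` also hold for `f`, then `e x ↦ f x` extends
to a homomorphism from the subalgebra generated by `e`. -/
noncomputable def lift {A : Type*} [BimodalGodelAlgebra A] (f : X → A)
    (h : ∀ s t : BimodalTerm X, s.eval e = t.eval e → s.eval f = t.eval f) :
    BimodalGodelHom (GeneratedSubalgebra e) A :=
  have key : ∀ (a : GeneratedSubalgebra e) (t : BimodalTerm X), t.eval e = a.1 →
      a.2.choose.eval f = t.eval f := fun a _ ht => h _ _ (a.2.choose_spec.trans ht.symm)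
  { toFun a := a.2.choose.eval f
    map_sup' a b := key (a ⊔ b) (.sup a.2.choose b.2.choose)
      (congrArg₂ (· ⊔ ·) a.2.choose_spec b.2.choose_spec)
    map_inf' a b := key (a ⊓ b) (.inf a.2.choose b.2.choose)
      (congrArg₂ (· ⊓ ·) a.2.choose_spec b.2.choose_spec)
    map_bot' := key ⊥ .bot rfl
    map_himp' a b := key (a ⇨ b) (.himp a.2.choose b.2.choose)
      (congrArg₂ (· ⇨ ·) a.2.choose_spec b.2.choose_spec)
    map_box a := key (box a) (.box a.2.choose) (congrArg box a.2.choose_spec)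
    map_dia a := key (dia a) (.dia a.2.choose) (congrArg dia a.2.choose_spec) }

theorem lift_apply {A : Type*} [BimodalGodelAlgebra A] (f : X → A)
    (h : ∀ s t : BimodalTerm X, s.eval e = t.eval e → s.eval f = t.eval f) (x : X) :
    (lift e f h).toFun ⟨e x, .var x, rfl⟩ = f x :=
  h _ (.var x) (Exists.choose_spec (p := fun t : BimodalTerm X => t.eval e = e x) ⟨.var x, rfl⟩)

end GeneratedSubalgebra

/-- An algebra belongs to a variety as soon as every equation that fails in it under the identity
assignment fails in some member of the variety. -/
theorem IsBimodalGodelVariety.mem_of_separating {V : Set BimodalGodelAlg.{u}}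
    (hV : IsBimodalGodelVariety V) (A : BimodalGodelAlg.{u})
    (h : ∀ s t : BimodalTerm A.carrier, s.eval id ≠ t.eval id →
      ∃ B ∈ V, ∃ f : A.carrier → B.carrier, s.eval f ≠ t.eval f) : A ∈ V := by
  -- One factor for each failing equation in the elements of `A`; `A` is then an image of the
  -- subalgebra of the product generated by the tuples `e x`.
  let ι : Type u := {z : BimodalTerm A.carrier × BimodalTerm A.carrier //
    z.1.eval (id : A.carrier → A.carrier) ≠ z.2.eval id}
  choose B hB f hf using fun i : ι => h i.1.1 i.1.2 i.2
  let e : A.carrier → ∀ i, (B i).carrier := fun x i => f i x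
  have he : ∀ s t : BimodalTerm A.carrier, s.eval e = t.eval e → s.eval id = t.eval id := by
    intro s t hst
    by_contra hne
    rw [BimodalTerm.eval_pi, BimodalTerm.eval_pi] at hst
    exact hf ⟨(s, t), hne⟩ (congrFun hst ⟨(s, t), hne⟩)
  exact hV.homImage_mem ⟨GeneratedSubalgebra e⟩
    (hV.subalgebra_mem _ (hV.product_mem ι B hB) ⟨GeneratedSubalgebra e⟩
      (GeneratedSubalgebra.inclusion e) fun _ _ => Subtype.ext) A
    (GeneratedSubalgebra.lift e id he)
    fun x => ⟨⟨e x, .var x, rfl⟩, GeneratedSubalgebra.lift_apply e id he x⟩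

end Generation

/-! ### Closure of the subvarieties, and soundness of the identities. -/

section Varieties

theorem BimodalGodelHom.monotone {A B : Type*} [BimodalGodelAlgebra A] [BimodalGodelAlgebra B]
    (f : BimodalGodelHom A B) {a b : A} (h : a ≤ b) : f.toFun a ≤ f.toFun b := by
  rw [← inf_eq_left, ← f.map_inf', inf_eq_left.2 h]

theorem BimodalGodelHom.le_iff {A B : Type*} [BimodalGodelAlgebra A] [BimodalGodelAlgebra B]
    (f : BimodalGodelHom A B) (hf : Function.Injective f.toFun) {a b : A} :
    f.toFun a ≤ f.toFun b ↔ a ≤ b := by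
  refine ⟨fun h => inf_eq_left.1 (hf ?_), f.monotone⟩
  exact (f.map_inf' a b).trans (inf_eq_left.2 h)

theorem isBimodalGodelVariety_modalSubvariety (P : Set ModalProperty) :
    IsBimodalGodelVariety (modalSubvariety.{u} P) where
  homImage_mem A hA B f hf p hp := by
    have h := hA p hp
    cases p <;> refine ⟨fun b => ?_, fun b => ?_⟩ <;> obtain ⟨a, rfl⟩ := hf b <;>
      simp only [← f.map_box, ← f.map_dia] <;>
      first | exact f.monotone (h.1 a) | exact f.monotone (h.2 a)
  subalgebra_mem A hA B f hf p hp := by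
    have h := hA p hp
    cases p <;> refine ⟨fun b => (f.le_iff hf).1 ?_, fun b => (f.le_iff hf).1 ?_⟩ <;>
      simp only [f.map_box, f.map_dia] <;>
      first | exact h.1 _ | exact h.2 _
  product_mem ι A hA p hp := by
    cases p
    · exact ⟨fun a i => (hA i _ hp).1 (a i), fun a i => (hA i _ hp).2 (a i)⟩
    · exact ⟨fun a i => (hA i _ hp).1 (a i), fun a i => (hA i _ hp).2 (a i)⟩
    · exact ⟨fun a i => (hA i _ hp).1 (a i), fun a i => (hA i _ hp).2 (a i)⟩

theorem complexAlgebra_satisfies {F : GKFrame.{u}} {p : ModalProperty} (hF : F.Has p) :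
    (complexAlgebra F).Satisfies p := by
  cases p with
  | reflexivity =>
    refine ⟨fun a w => ?_, fun a w => ?_⟩
    · change ⨅ w', (F.S w w' ⇨ a w') ≤ a w
      refine (iInf_le _ w).trans ?_
      rw [hF w]
      exact (top_himp (a := a w)).le
    · change a w ≤ ⨆ w', (F.S w w' ⊓ a w')
      refine le_trans ?_ (le_iSup (fun w' => F.S w w' ⊓ a w') w)
      rw [hF w]
      exact le_inf le_top le_rfl
  | transitivity =>
    refine ⟨fun a w => ?_, fun a w => ?_⟩
    · change ⨅ w', (F.S w w' ⇨ a w') ≤ ⨅ v, (F.S w v ⇨ ⨅ z, (F.S v z ⇨ a z))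
      refine le_iInf fun v => le_himp_iff.2 (le_iInf fun z => le_himp_iff.2 ?_)
      rw [inf_assoc, ← le_himp_iff]
      exact (iInf_le _ z).trans (himp_le_himp_right (hF w v z))
    · change ⨆ v, (F.S w v ⊓ ⨆ z, (F.S v z ⊓ a z)) ≤ ⨆ w', (F.S w w' ⊓ a w')
      refine iSup_le fun v => ?_
      rw [inf_comm, ← le_himp_iff]
      refine iSup_le fun z => le_himp_iff.2 ?_
      refine le_trans ?_ (le_iSup (fun w' => F.S w w' ⊓ a w') z)
      exact le_inf ((le_inf inf_le_right (inf_le_left.trans inf_le_left)).trans (hF w v z))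
        (inf_le_left.trans inf_le_right)
  | symmetry =>
    refine ⟨fun a w => ?_, fun a w => ?_⟩
    · change a w ≤ ⨅ v, (F.S w v ⇨ ⨆ z, (F.S v z ⊓ a z))
      refine le_iInf fun v => le_himp_iff.2 ?_
      rw [hF w v, inf_comm]
      exact le_iSup (fun z => F.S v z ⊓ a z) w
    · change ⨆ v, (F.S w v ⊓ ⨅ z, (F.S v z ⇨ a z)) ≤ a w
      refine iSup_le fun v => ?_
      rw [hF w v, inf_comm, ← le_himp_iff]
      exact iInf_le _ w

theorem subset_generatedVariety (K : Set BimodalGodelAlg.{u}) : K ⊆ generatedVariety K :=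
  Set.subset_sInter fun _ hC => hC.2

theorem isBimodalGodelVariety_generatedVariety (K : Set BimodalGodelAlg.{u}) :
    IsBimodalGodelVariety (generatedVariety K) where
  homImage_mem A hA B f hf C hC := hC.1.homImage_mem A (hA C hC) B f hf
  subalgebra_mem A hA B f hf C hC := hC.1.subalgebra_mem A (hA C hC) B f hf
  product_mem ι A hA C hC := hC.1.product_mem ι A fun i => hA i C hC

theorem generatedVariety_mono {K K' : Set BimodalGodelAlg.{u}} (h : K ⊆ K') :
    generatedVariety K ⊆ generatedVariety K' :=
  Set.sInter_subset_sInter fun _ hC => ⟨hC.1, h.trans hC.2⟩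

theorem modalSubvariety_subset_generatedVariety (P : Set ModalProperty) :
    modalSubvariety P ⊆ generatedVariety {A : BimodalGodelAlg.{u} |
      ∃ F : GKFrame.{u}, (∀ p ∈ P, F.Has p) ∧ A = complexAlgebra F} := fun A hA =>
  (isBimodalGodelVariety_generatedVariety _).mem_of_separating A fun _ _ hst => by
    obtain ⟨G, f, hG, hf⟩ := BimodalTerm.exists_frame_separating hA id hst
    exact ⟨complexAlgebra G, subset_generatedVariety _ ⟨G, hG, rfl⟩, f, hf⟩

end Varieties

theorem mainTheorem4 :
    -- the complex algebras generate the variety of all bi-modal Gödel algebras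
    generatedVariety {A : BimodalGodelAlg.{u} | ∃ F : GKFrame.{u}, A = complexAlgebra F}
        = Set.univ ∧
    -- for each combination of properties, the corresponding subvariety is generated by the
    -- complex algebras over frames with these properties, and likewise by the complex algebras
    -- lying in it
    ∀ P : Set ModalProperty,
      generatedVariety {A : BimodalGodelAlg.{u} |
          ∃ F : GKFrame.{u}, (∀ p ∈ P, F.Has p) ∧ A = complexAlgebra F}
        = modalSubvariety P ∧
      generatedVariety {A : BimodalGodelAlg.{u} |
          (∃ F : GKFrame.{u}, A = complexAlgebra F) ∧ A ∈ modalSubvariety P}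
        = modalSubvariety P := by
  refine ⟨Set.eq_univ_of_forall fun A => ?_, fun P => ?_⟩
  -- The case `P = ∅`, where no identity is imposed.
  · refine generatedVariety_mono ?_ (modalSubvariety_subset_generatedVariety ∅ (a := A)
      fun p hp => absurd hp (Set.notMem_empty p))
    rintro _ ⟨F, -, rfl⟩
    exact ⟨F, rfl⟩
  · have h1 := modalSubvariety_subset_generatedVariety.{u} P
    have h2 : {A : BimodalGodelAlg.{u} |
          ∃ F : GKFrame.{u}, (∀ p ∈ P, F.Has p) ∧ A = complexAlgebra F} ⊆
        {A | (∃ F : GKFrame.{u}, A = complexAlgebra F) ∧ A ∈ modalSubvariety P} := by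
      rintro _ ⟨F, hF, rfl⟩
      exact ⟨⟨F, rfl⟩, fun p hp => complexAlgebra_satisfies (hF p hp)⟩
    have h3 : generatedVariety {A : BimodalGodelAlg.{u} |
        (∃ F : GKFrame.{u}, A = complexAlgebra F) ∧ A ∈ modalSubvariety P} ⊆
        modalSubvariety P :=
      Set.sInter_subset_of_mem ⟨isBimodalGodelVariety_modalSubvariety P, fun A hA => hA.2⟩
    exact ⟨Set.Subset.antisymm ((generatedVariety_mono h2).trans h3) h1,
      Set.Subset.antisymm h3 (h1.trans (generatedVariety_mono h2))⟩
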